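/- Let $p$ be a real polynomial of degree $d>1$, regarded as a map of the Riemann sphere $\mathbb{C}_\infty=\mathbb{C}\cup\{\infty\}$ to itself with $p(\infty)=\infty$. The Fatou set of $p$ is the set of all $z\in\mathbb{C}_\infty$ that have an open neighbourhood on which the sequence of iterates $(p^{(n)})_{n\in\mathbb{N}}$ is equicontinuous with respect to the chordal metric, and the Julia set $\mathcal{J}(p)$ is its complement in $\mathbb{C}_\infty$. Then $\mathcal{J}(p)\subseteq\mathbb{R}$ if and only if there exist real numbers $a<b$ such that $$\{z\in\mathbb{C} : p(z)\in[a,b]\}\subseteq[a,b].$$ -/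

import Mathlib

open Polynomial

noncomputable section

/-- The chordal metric on the Riemann sphere `OnePoint ℂ`. -/
def chordalDist : OnePoint ℂ → OnePoint ℂ → ℝ
  | .some z, .some w => 2 * ‖z - w‖ / (√(1 + ‖z‖ ^ 2) * √(1 + ‖w‖ ^ 2))
  | .some z, .infty => 2 / √(1 + ‖z‖ ^ 2)
  | .infty, .some w => 2 / √(1 + ‖w‖ ^ 2)
  | .infty, .infty => 0

/-- A sequence of self-maps of the Riemann sphere is equicontinuous on `U` in the chordal
metric. -/
def ChordalEquicontinuousOn (F : ℕ → OnePoint ℂ → OnePoint ℂ) (U : Set (OnePoint ℂ)) : Prop :=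
  ∀ z ∈ U, ∀ ε > (0 : ℝ), ∃ δ > (0 : ℝ), ∀ w ∈ U, chordalDist z w < δ →
    ∀ n : ℕ, chordalDist (F n z) (F n w) < ε

/-- The Fatou set of a self-map of the Riemann sphere: the points with an open neighbourhood on
which the sequence of iterates is equicontinuous in the chordal metric. -/
def fatouSet (f : OnePoint ℂ → OnePoint ℂ) : Set (OnePoint ℂ) :=
  {z | ∃ U : Set (OnePoint ℂ), IsOpen U ∧ z ∈ U ∧ ChordalEquicontinuousOn (fun n => f^[n]) U}

/-- The Julia set of a self-map of the Riemann sphere: the complement of the Fatou set. -/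
def juliaSet (f : OnePoint ℂ → OnePoint ℂ) : Set (OnePoint ℂ) :=
  (fatouSet f)ᶜ

/-- A (nonconstant) complex polynomial as a self-map of the Riemann sphere, with `∞ ↦ ∞`. -/
def sphereMap (p : ℂ[X]) : OnePoint ℂ → OnePoint ℂ :=
  OnePoint.map fun z => p.eval z

/-- The real line as a subset of the Riemann sphere (the point at infinity is not real). -/
def realLine : Set (OnePoint ℂ) :=
  Set.range fun x : ℝ => ((x : ℂ) : OnePoint ℂ)

/-- The real interval `[a, b]` as a subset of the complex plane. -/
def realInterval (a b : ℝ) : Set ℂ :=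
  (fun x : ℝ => (x : ℂ)) '' Set.Icc a b

end

open Filter Topology

/-! ### The chordal metric: compatibility with the topology of the sphere, and equicontinuity near
infinity. -/

section Chordal

/-! Everything passes through the filled Julia set `K = boundedOrbits q R`, with `R` an escape
radius. Points off `K` and infinity are Fatou, and a Fatou point of `K` is interior to `K`; so the
Julia set lies in `K`.

If the Julia set is real, connectedness of the open half-planes makes `K` real
(`IsEscapeRadius.im_eq_zero_of_mem`). Take `a`, `b` to be the extremes of `K`. The preimages of `a`
and `b` lie in `K`, hence in `[a, b]`, and `preimage_realInterval_subset` extends this to all of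
`[a, b]`: a highest nonreal preimage would contradict the sign of a logarithmic derivative, and the
real ones are handled by intermediate values.

Conversely, suppose `z ∈ K` lies off `[a, b]`. All iterates `P` omit `[a, b]` on a fixed disc about
`z`. The roots of `P - a` lie in `[a, b]`, so `P' / (P - a)` at `z` is at least of the order of the
degree (`natDegree_mul_le_norm_derivative`). A Cauchy estimate
(`norm_deriv_mul_le_of_omits_realInterval`) bounds the same quotient by a multiple of `‖P z - b‖`,
which is bounded along the orbit. Exponential degree growth is then impossible, so `K ⊆ [a, b]`. -/

theorem chordalDist_coe_coe (z w : ℂ) : chordalDist z w =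
    2 * ‖z - w‖ / (√(1 + ‖z‖ ^ 2) * √(1 + ‖w‖ ^ 2)) := rfl

theorem chordalDist_infty_coe (w : ℂ) : chordalDist OnePoint.infty w = 2 / √(1 + ‖w‖ ^ 2) := rfl

theorem chordalDist_coe_infty (w : ℂ) : chordalDist w OnePoint.infty = 2 / √(1 + ‖w‖ ^ 2) := rfl

theorem chordalDist_infty_infty : chordalDist OnePoint.infty OnePoint.infty = 0 := rfl

theorem chordalDist_comm (x y : OnePoint ℂ) : chordalDist x y = chordalDist y x := by
  induction x using OnePoint.rec <;> induction y using OnePoint.rec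
  · rfl
  · rfl
  · rfl
  · rw [chordalDist_coe_coe, chordalDist_coe_coe, norm_sub_rev, mul_comm √_]

theorem le_sqrt_one_add_sq (x : ℝ) : x ≤ √(1 + x ^ 2) :=
  Real.le_sqrt_of_sq_le (by linarith)

theorem sqrt_one_add_sq_le {x : ℝ} (hx : 0 ≤ x) : √(1 + x ^ 2) ≤ 1 + x :=
  Real.sqrt_le_iff.2 ⟨by linarith, by nlinarith⟩

/-- The triangle inequality through the point at infinity. -/
theorem chordalDist_le_add_infty (x y : OnePoint ℂ) :
    chordalDist x y ≤ chordalDist OnePoint.infty x + chordalDist OnePoint.infty y := by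
  induction x using OnePoint.rec with
  | infty => rw [chordalDist_infty_infty, zero_add]
  | coe z =>
    induction y using OnePoint.rec with
    | infty => rw [chordalDist_comm, chordalDist_infty_infty, add_zero]
    | coe w =>
      rw [chordalDist_coe_coe, chordalDist_infty_coe, chordalDist_infty_coe]
      have hz : 0 < √(1 + ‖z‖ ^ 2) := by positivity
      have hw : 0 < √(1 + ‖w‖ ^ 2) := by positivity
      rw [div_add_div _ _ hz.ne' hw.ne']
      gcongr
      linarith [norm_sub_le z w, le_sqrt_one_add_sq ‖z‖, le_sqrt_one_add_sq ‖w‖]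

theorem tendsto_chordalDist_infty_coe :
    Tendsto (fun w : ℂ => chordalDist OnePoint.infty w) (Bornology.cobounded ℂ) (𝓝 0) := by
  have h : Tendsto (fun w : ℂ => √(1 + ‖w‖ ^ 2)) (Bornology.cobounded ℂ) atTop :=
    tendsto_atTop_mono (fun w => le_sqrt_one_add_sq ‖w‖) tendsto_norm_cobounded_atTop
  exact h.const_div_atTop 2

theorem continuous_chordalDist_coe_coe (z : ℂ) : Continuous fun w : ℂ => chordalDist z w := by
  simp only [chordalDist_coe_coe]
  refine Continuous.div (by fun_prop) (by fun_prop) fun w => by positivity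

theorem eventually_chordalDist_lt (x : OnePoint ℂ) {ε : ℝ} (hε : 0 < ε) :
    ∀ᶠ y in 𝓝 x, chordalDist x y < ε := by
  induction x using OnePoint.rec with
  | infty =>
    rw [OnePoint.nhds_infty_eq, eventually_sup, eventually_map, eventually_pure,
      chordalDist_infty_infty, coclosedCompact_eq_cocompact, ← Metric.cobounded_eq_cocompact]
    exact ⟨tendsto_chordalDist_infty_coe.eventually_lt_const hε, hε⟩
  | coe z =>
    rw [OnePoint.nhds_coe_eq, eventually_map]
    refine (continuous_chordalDist_coe_coe z).continuousAt.eventually_lt_const ?_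
    simpa [chordalDist_coe_coe] using hε

theorem exists_chordalDist_lt_imp_mem {x : OnePoint ℂ} {U : Set (OnePoint ℂ)} (hU : U ∈ 𝓝 x) :
    ∃ δ > 0, ∀ y, chordalDist x y < δ → y ∈ U := by
  induction x using OnePoint.rec with
  | infty =>
    rw [OnePoint.nhds_infty_eq, mem_sup, mem_map, mem_pure, coclosedCompact_eq_cocompact,
      ← Metric.cobounded_eq_cocompact] at hU
    obtain ⟨r, -, hr⟩ := (Metric.hasBasis_cobounded_compl_closedBall (0 : ℂ)).mem_iff.1 hU.1
    refine ⟨2 / √(1 + r ^ 2), by positivity, fun y hy => ?_⟩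
    induction y using OnePoint.rec with
    | infty => exact hU.2
    | coe w =>
      rw [chordalDist_infty_coe] at hy
      refine hr ?_
      simp only [Set.mem_compl_iff, Metric.mem_closedBall, dist_zero_right, not_le]
      by_contra! h
      refine hy.not_ge ?_
      have := norm_nonneg w
      gcongr
  | coe z =>
    rw [OnePoint.nhds_coe_eq, mem_map] at hU
    obtain ⟨η, hη, hr⟩ := Metric.mem_nhds_iff.1 hU
    have hz : 0 < √(1 + ‖z‖ ^ 2) := by positivity
    -- The summand 1 makes the radius small enough to exclude infinity; the other term excludes
    -- finite points at distance at least `η`.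
    refine ⟨2 / (√(1 + ‖z‖ ^ 2) * ((1 + ‖z‖) / η + 1)), by positivity, fun y hy => ?_⟩
    induction y using OnePoint.rec with
    | infty =>
      rw [chordalDist_coe_infty] at hy
      refine absurd hy (not_lt.2 ?_)
      gcongr
      exact le_mul_of_one_le_right hz.le (by simp; positivity)
    | coe w =>
      rw [chordalDist_coe_coe] at hy
      refine hr ?_
      rw [Metric.mem_ball, dist_comm, dist_eq_norm]
      by_contra! h
      refine hy.not_ge ?_
      rw [div_le_div_iff₀ (by positivity) (by positivity)]
      have h1 : √(1 + ‖w‖ ^ 2) ≤ ((1 + ‖z‖) / η + 1) * ‖z - w‖ := by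
        have h2 : ‖w‖ ≤ ‖z‖ + ‖z - w‖ := by
          simpa using norm_sub_le z (z - w)
        have h3 : 1 + ‖z‖ ≤ (1 + ‖z‖) / η * ‖z - w‖ := by
          rw [div_mul_eq_mul_div, le_div_iff₀ hη]
          gcongr
        linarith [sqrt_one_add_sq_le (norm_nonneg w)]
      calc 2 * (√(1 + ‖z‖ ^ 2) * √(1 + ‖w‖ ^ 2))
          ≤ 2 * (√(1 + ‖z‖ ^ 2) * (((1 + ‖z‖) / η + 1) * ‖z - w‖)) := by gcongr
        _ = _ := by ring

theorem exists_chordalDist_lt_of_continuous {F : OnePoint ℂ → OnePoint ℂ} (hF : Continuous F)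
    (x : OnePoint ℂ) {ε : ℝ} (hε : 0 < ε) :
    ∃ δ > 0, ∀ y, chordalDist x y < δ → chordalDist (F x) (F y) < ε :=
  exists_chordalDist_lt_imp_mem (hF.continuousAt.eventually (eventually_chordalDist_lt (F x) hε))

/-- A sequence of continuous maps which tends to infinity uniformly on `U` is equicontinuous
on `U`. -/
theorem chordalEquicontinuousOn_of_tendsto_infty {F : ℕ → OnePoint ℂ → OnePoint ℂ}
    (hF : ∀ n, Continuous (F n)) {U : Set (OnePoint ℂ)}
    (h : ∀ ε > 0, ∃ N, ∀ n ≥ N, ∀ y ∈ U, chordalDist OnePoint.infty (F n y) < ε) :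
    ChordalEquicontinuousOn F U := by
  intro x hx ε hε
  obtain ⟨N, hN⟩ := h (ε / 2) (by linarith)
  have hfin : ∀ M, ∃ δ > 0, ∀ y, chordalDist x y < δ →
      ∀ n < M, chordalDist (F n x) (F n y) < ε := by
    intro M
    induction M with
    | zero => exact ⟨1, one_pos, by simp⟩
    | succ M ih =>
      obtain ⟨δ, hδ, h1⟩ := ih
      obtain ⟨δ', hδ', h2⟩ := exists_chordalDist_lt_of_continuous (hF M) x hε
      refine ⟨min δ δ', lt_min hδ hδ', fun y hy n hn => ?_⟩
      rw [lt_min_iff] at hy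
      rcases Nat.lt_succ_iff_lt_or_eq.1 hn with hn | rfl
      · exact h1 y hy.1 n hn
      · exact h2 y hy.2
  obtain ⟨δ, hδ, h1⟩ := hfin N
  refine ⟨δ, hδ, fun y hyU hy n => ?_⟩
  rcases lt_or_ge n N with hn | hn
  · exact h1 y hy n hn
  · linarith [chordalDist_le_add_infty (F n x) (F n y), hN n hn x hx, hN n hn y hyU]

/-- Points which are chordally close to the ball of radius `R` are bounded. -/
theorem norm_le_of_chordalDist_lt {R : ℝ} (hR : 1 ≤ R) {z w : ℂ} (hz : ‖z‖ ≤ R)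
    (h : chordalDist z w < 1 / (2 * √(1 + R ^ 2))) : ‖w‖ ≤ 2 * R := by
  by_contra! hw
  refine h.not_ge ?_
  rw [chordalDist_coe_coe, div_le_div_iff₀ (by positivity) (by positivity)]
  have h1 : ‖w‖ / 2 ≤ ‖z - w‖ := by
    have := norm_sub_norm_le w z
    rw [norm_sub_rev] at this
    linarith
  have h2 : √(1 + ‖w‖ ^ 2) ≤ 2 * ‖w‖ := by
    linarith [sqrt_one_add_sq_le (norm_nonneg w)]
  have h3 : √(1 + ‖z‖ ^ 2) ≤ √(1 + R ^ 2) := by gcongr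
  calc 1 * (√(1 + ‖z‖ ^ 2) * √(1 + ‖w‖ ^ 2)) ≤ 1 * (√(1 + R ^ 2) * (2 * ‖w‖)) := by gcongr
    _ = 2 * (‖w‖ / 2) * (2 * √(1 + R ^ 2)) := by ring
    _ ≤ _ := by gcongr

end Chordal

/-! ### Escape radius, filled Julia set and Fatou set. -/

section Escape

/-- `R` is an escape radius for `q`. -/
def IsEscapeRadius (q : ℂ[X]) (R : ℝ) : Prop :=
  1 ≤ R ∧ ∀ z : ℂ, R ≤ ‖z‖ → 2 * ‖z‖ ≤ ‖q.eval z‖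

/-- The points whose orbit under `q` stays in the closed ball of radius `R`. -/
def boundedOrbits (q : ℂ[X]) (R : ℝ) : Set ℂ :=
  {z | ∀ n, ‖(fun w => q.eval w)^[n] z‖ ≤ R}

/-- Write `q = q.divX * X + q(0)`: far out `‖q.divX‖ ≥ 3`, and the constant term costs at most one
more `‖z‖`. -/
theorem exists_isEscapeRadius {q : ℂ[X]} (hq : 1 < q.natDegree) : ∃ R, IsEscapeRadius q R := by
  have hdeg : 0 < q.divX.degree := by
    rw [← natDegree_pos_iff_degree_pos, natDegree_divX_eq_natDegree_tsub_one]
    omega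
  have h := q.divX.tendsto_norm_atTop hdeg (tendsto_norm_cobounded_atTop (E := ℂ))
  have h3 := h.eventually_ge_atTop 3
  obtain ⟨r, -, hr⟩ := (Metric.hasBasis_cobounded_compl_ball (0 : ℂ)).mem_iff.1 h3
  refine ⟨max r (max 1 ‖q.coeff 0‖), by simp, fun z hz => ?_⟩
  simp only [max_le_iff] at hz
  have h4 : 3 ≤ ‖q.divX.eval z‖ := hr (by simpa using hz.1)
  have h5 : q.eval z = q.divX.eval z * z + q.coeff 0 := by
    conv_lhs => rw [← divX_mul_X_add q]
    simp
  have h6 : ‖q.divX.eval z * z‖ - ‖q.coeff 0‖ ≤ ‖q.eval z‖ := by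
    rw [h5]
    simpa using norm_sub_norm_le (q.divX.eval z * z) (-q.coeff 0)
  rw [norm_mul] at h6
  nlinarith [norm_nonneg z]

variable {q : ℂ[X]} {R : ℝ}

theorem continuous_iterate_eval (q : ℂ[X]) (n : ℕ) : Continuous (fun w => q.eval w)^[n] :=
  q.continuous.iterate n

theorem IsEscapeRadius.pow_mul_le (h : IsEscapeRadius q R) {z : ℂ} (hz : R ≤ ‖z‖) (n : ℕ) :
    2 ^ n * R ≤ ‖(fun w => q.eval w)^[n] z‖ := by
  have hR := h.1
  induction n with
  | zero => simpa using hz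
  | succ n ih =>
    rw [Function.iterate_succ_apply']
    have h1 : (1 : ℝ) ≤ 2 ^ n := one_le_pow₀ one_le_two
    have h2 := h.2 _ (by nlinarith : R ≤ ‖(fun w => q.eval w)^[n] z‖)
    rw [pow_succ]
    linarith

/-- An orbit that once leaves the ball of radius `R` grows geometrically, so any bound whatever
forces the bound `R`. -/
theorem IsEscapeRadius.mem_of_bounded (h : IsEscapeRadius q R) {z : ℂ} {B : ℝ}
    (hz : ∀ n, ‖(fun w => q.eval w)^[n] z‖ ≤ B) : z ∈ boundedOrbits q R := by
  intro n
  by_contra! hn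
  obtain ⟨m, hm⟩ := pow_unbounded_of_one_lt B one_lt_two
  have h1 := h.pow_mul_le hn.le m
  rw [← Function.iterate_add_apply] at h1
  have := hz (m + n)
  have := h.1
  have : (0 : ℝ) < 2 ^ m := by positivity
  nlinarith

theorem IsEscapeRadius.eval_mem_iff (h : IsEscapeRadius q R) {z : ℂ} :
    q.eval z ∈ boundedOrbits q R ↔ z ∈ boundedOrbits q R := by
  constructor
  · intro hz
    refine h.mem_of_bounded (B := max R ‖z‖) fun n => ?_
    cases n with
    | zero => simp
    | succ n =>
      rw [Function.iterate_succ_apply]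
      exact (hz n).trans (le_max_left _ _)
  · intro hz n
    have := hz (n + 1)
    rwa [Function.iterate_succ_apply] at this

theorem isClosed_boundedOrbits (q : ℂ[X]) (R : ℝ) : IsClosed (boundedOrbits q R) := by
  simp only [boundedOrbits, Set.ofPred_forall]
  exact isClosed_iInter fun n =>
    isClosed_le (continuous_iterate_eval q n).norm continuous_const

theorem norm_le_of_mem_boundedOrbits {z : ℂ} (hz : z ∈ boundedOrbits q R) : ‖z‖ ≤ R := hz 0

theorem isCompact_boundedOrbits (q : ℂ[X]) (R : ℝ) : IsCompact (boundedOrbits q R) :=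
  (isCompact_closedBall (0 : ℂ) R).of_isClosed_subset (isClosed_boundedOrbits q R)
    fun _ hz => by simpa using norm_le_of_mem_boundedOrbits hz

theorem IsEscapeRadius.mem_of_isFixedPt (h : IsEscapeRadius q R) {z : ℂ} (hz : q.eval z = z) :
    z ∈ boundedOrbits q R := by
  refine h.mem_of_bounded (B := ‖z‖) fun n => ?_
  rw [Function.iterate_fixed hz]

theorem exists_isFixedPt (hq : 1 < q.natDegree) : ∃ z, q.eval z = z := by
  have hd : (q - X).natDegree = q.natDegree :=
    natDegree_sub_eq_left_of_natDegree_lt (by rwa [natDegree_X])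
  obtain ⟨z, hz⟩ := IsAlgClosed.exists_root (q - X) (by
    refine (natDegree_pos_iff_degree_pos.1 ?_).ne'
    omega)
  exact ⟨z, by simpa [sub_eq_zero] using hz⟩

theorem continuous_sphereMap (hq : 0 < q.natDegree) : Continuous (sphereMap q) := by
  refine OnePoint.continuous_map q.continuous ?_
  rw [coclosedCompact_eq_cocompact, ← Metric.cobounded_eq_cocompact,
    ← tendsto_norm_atTop_iff_cobounded]
  exact q.tendsto_norm_atTop (natDegree_pos_iff_degree_pos.1 hq) tendsto_norm_cobounded_atTop

theorem iterate_sphereMap_coe (q : ℂ[X]) (n : ℕ) (z : ℂ) :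
    (sphereMap q)^[n] z = ((fun w => q.eval w)^[n] z : ℂ) := by
  induction n generalizing z with
  | zero => rfl
  | succ n ih => exact ih _

theorem iterate_sphereMap_infty (q : ℂ[X]) (n : ℕ) :
    (sphereMap q)^[n] OnePoint.infty = OnePoint.infty :=
  Function.iterate_fixed rfl n

/-- Every point outside the set of bounded orbits has a neighbourhood, which also contains
infinity, on which the iterates escape uniformly. -/
theorem IsEscapeRadius.subset_fatouSet (h : IsEscapeRadius q R) (hq : 0 < q.natDegree) (N : ℕ) :
    ((↑) '' {z : ℂ | ‖(fun w => q.eval w)^[N] z‖ ≤ R} : Set (OnePoint ℂ))ᶜ ⊆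
      fatouSet (sphereMap q) := by
  intro x hx
  have hcl : IsClosed {z : ℂ | ‖(fun w => q.eval w)^[N] z‖ ≤ R} :=
    isClosed_le (continuous_iterate_eval q N).norm continuous_const
  have hcp : IsCompact {z : ℂ | ‖(fun w => q.eval w)^[N] z‖ ≤ R} := by
    obtain ⟨r, hr⟩ : ∃ r, {z : ℂ | ‖(fun w => q.eval w)^[N] z‖ ≤ R} ⊆ Metric.closedBall 0 r := by
      refine ⟨R, fun z hz => ?_⟩
      by_contra! hzR
      have hzR : R < ‖z‖ := by simpa using hzR
      cases N with
      | zero => exact hzR.not_ge hz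
      | succ N =>
        have h1 := h.pow_mul_le hzR.le (N + 1)
        have h2 : (1 : ℝ) < 2 ^ (N + 1) := one_lt_pow₀ one_lt_two (by simp)
        have h3 : ‖(fun w => q.eval w)^[N + 1] z‖ ≤ R := hz
        nlinarith [h.1]
    exact (isCompact_closedBall (0 : ℂ) r).of_isClosed_subset hcl hr
  refine ⟨_, OnePoint.isOpen_compl_image_coe.2 ⟨hcl, hcp⟩, hx,
    chordalEquicontinuousOn_of_tendsto_infty (fun n => (continuous_sphereMap hq).iterate n) ?_⟩
  intro ε hε
  obtain ⟨m, hm⟩ := pow_unbounded_of_one_lt (2 / ε) one_lt_two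
  refine ⟨m + N, fun n hn y hy => ?_⟩
  induction y using OnePoint.rec with
  | infty => rwa [iterate_sphereMap_infty, chordalDist_infty_infty]
  | coe w =>
    have hw : R < ‖(fun w => q.eval w)^[N] w‖ := by
      by_contra! hw
      exact hy ⟨w, hw, rfl⟩
    have h1 := h.pow_mul_le hw.le (n - N)
    rw [← Function.iterate_add_apply, Nat.sub_add_cancel (by omega)] at h1
    rw [iterate_sphereMap_coe, chordalDist_infty_coe]
    have h2 : (2 : ℝ) ^ m ≤ 2 ^ (n - N) := pow_le_pow_right₀ one_le_two (by omega)
    have h3 : 2 / ε < √(1 + ‖(fun w => q.eval w)^[n] w‖ ^ 2) := by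
      have := le_sqrt_one_add_sq ‖(fun w => q.eval w)^[n] w‖
      have h4 : (2 : ℝ) ^ (n - N) ≤ 2 ^ (n - N) * R :=
        le_mul_of_one_le_right (by positivity) h.1
      linarith
    rw [div_lt_iff₀ (by positivity)]
    rwa [div_lt_iff₀ hε, mul_comm] at h3

theorem IsEscapeRadius.infty_mem_fatouSet (h : IsEscapeRadius q R) (hq : 0 < q.natDegree) :
    OnePoint.infty ∈ fatouSet (sphereMap q) :=
  h.subset_fatouSet hq 0 (by simp)

theorem IsEscapeRadius.coe_mem_fatouSet (h : IsEscapeRadius q R) (hq : 0 < q.natDegree) {z : ℂ}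
    (hz : z ∉ boundedOrbits q R) : (z : OnePoint ℂ) ∈ fatouSet (sphereMap q) := by
  simp only [boundedOrbits, Set.mem_ofPred_eq, not_forall, not_le] at hz
  obtain ⟨N, hN⟩ := hz
  refine h.subset_fatouSet hq N ?_
  rintro ⟨w, hw, hwz⟩
  rw [OnePoint.coe_eq_coe] at hwz
  subst hwz
  exact hN.not_ge hw

/-- Equicontinuity keeps nearby orbits chordally close to one in the ball of radius `R`, hence
within radius `2 * R`, and bounded orbits already stay within `R`. -/
theorem IsEscapeRadius.mem_nhds_of_mem_fatouSet (h : IsEscapeRadius q R) {z : ℂ}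
    (hz : z ∈ boundedOrbits q R) (hF : (z : OnePoint ℂ) ∈ fatouSet (sphereMap q)) :
    boundedOrbits q R ∈ 𝓝 z := by
  obtain ⟨U, hU, hzU, hE⟩ := hF
  obtain ⟨δ, hδ, hE⟩ := hE z hzU (1 / (2 * √(1 + R ^ 2))) (by positivity)
  have h1 : ∀ᶠ w : ℂ in 𝓝 z, (w : OnePoint ℂ) ∈ U :=
    OnePoint.continuous_coe.continuousAt.eventually (hU.mem_nhds hzU)
  have h2 : ∀ᶠ w : ℂ in 𝓝 z, chordalDist z w < δ :=
    OnePoint.continuous_coe.continuousAt.eventually (eventually_chordalDist_lt _ hδ)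
  filter_upwards [h1, h2] with w hwU hw
  refine h.mem_of_bounded (B := 2 * R) fun n => ?_
  have h3 := hE w hwU hw n
  simp only [iterate_sphereMap_coe] at h3
  exact norm_le_of_chordalDist_lt h.1 (hz n) h3

end Escape

/-! ### Membership in real intervals and in the real line. -/

section RealInterval

theorem mem_realInterval {a b : ℝ} {z : ℂ} :
    z ∈ realInterval a b ↔ z.im = 0 ∧ a ≤ z.re ∧ z.re ≤ b := by
  constructor
  · rintro ⟨x, hx, rfl⟩
    simpa using hx
  · rintro ⟨h0, h1, h2⟩
    exact ⟨z.re, ⟨h1, h2⟩, Complex.ext (by simp) (by simp [h0])⟩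

theorem isCompact_realInterval (a b : ℝ) : IsCompact (realInterval a b) :=
  isCompact_Icc.image Complex.continuous_ofReal

theorem ofReal_mem_realInterval {a b x : ℝ} : (x : ℂ) ∈ realInterval a b ↔ a ≤ x ∧ x ≤ b := by
  simp [mem_realInterval]

theorem coe_mem_realLine {z : ℂ} : (z : OnePoint ℂ) ∈ realLine ↔ z.im = 0 := by
  constructor
  · rintro ⟨x, hx⟩
    rw [← OnePoint.coe_eq_coe.1 hx]
    simp
  · intro h
    exact ⟨z.re, congrArg _ (Complex.ext (by simp) (by simp [h]))⟩

end RealInterval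

/-! ### A real Julia set forces a real filled Julia set, which has more than one point. -/

section RealJulia

variable {q : ℂ[X]} {R : ℝ}

/-- A connected set free of Julia points is covered by the disjoint open sets `interior K` and `Kᶜ`;
its point beyond `R` decides for the latter. -/
theorem IsEscapeRadius.disjoint_of_convex (h : IsEscapeRadius q R)
    (hJ : juliaSet (sphereMap q) ⊆ realLine) {s : Set ℂ} (hs : Convex ℝ s)
    (hreal : ∀ z ∈ s, z.im ≠ 0) (hR : ∃ z ∈ s, R < ‖z‖) : s ⊆ (boundedOrbits q R)ᶜ := by
  refine hs.isPreconnected.subset_right_of_subset_union (u := interior (boundedOrbits q R))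
    isOpen_interior (isClosed_boundedOrbits q R).isOpen_compl
    (disjoint_compl_right.mono_left interior_subset) ?_ ?_
  · intro z hz
    by_cases hzK : z ∈ boundedOrbits q R
    · left
      rw [mem_interior_iff_mem_nhds]
      refine h.mem_nhds_of_mem_fatouSet hzK ?_
      by_contra hF
      exact hreal z hz (coe_mem_realLine.1 (hJ hF))
    · exact Or.inr hzK
  · obtain ⟨z, hz, hzR⟩ := hR
    exact ⟨z, hz, fun hK => hzR.not_ge (norm_le_of_mem_boundedOrbits hK)⟩

theorem IsEscapeRadius.im_eq_zero_of_mem (h : IsEscapeRadius q R)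
    (hJ : juliaSet (sphereMap q) ⊆ realLine) {z : ℂ} (hz : z ∈ boundedOrbits q R) : z.im = 0 := by
  have hR : 0 < R + 1 := by linarith [h.1]
  have hn : R < ‖((R + 1 : ℝ) : ℂ) * Complex.I‖ := by
    rw [norm_mul, Complex.norm_I, mul_one, Complex.norm_real, Real.norm_of_nonneg hR.le]
    linarith
  by_contra h0
  rcases lt_or_gt_of_ne h0 with h0 | h0
  · exact h.disjoint_of_convex hJ (s := {z | z.im < 0}) (convex_halfSpace_im_lt 0)
      (fun z hz => ne_of_lt hz)
      ⟨-(((R + 1 : ℝ) : ℂ) * Complex.I), by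
        change (-(((R + 1 : ℝ) : ℂ) * Complex.I)).im < 0
        rwa [Complex.neg_im, Complex.im_ofReal_mul, Complex.I_im, mul_one, neg_lt_zero], by rwa [norm_neg]⟩ h0 hz
  · exact h.disjoint_of_convex hJ (s := {z | 0 < z.im}) (convex_halfSpace_im_gt 0)
      (fun z hz => ne_of_gt hz)
      ⟨((R + 1 : ℝ) : ℂ) * Complex.I, by
        change 0 < (((R + 1 : ℝ) : ℂ) * Complex.I).im
        rwa [Complex.im_ofReal_mul, Complex.I_im, mul_one], hn⟩ h0 hz

/-- The set of bounded orbits is not a single point. -/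
theorem IsEscapeRadius.exists_ne_mem (h : IsEscapeRadius q R) (hq : 1 < q.natDegree) {x : ℂ}
    (hx : x ∈ boundedOrbits q R) : ∃ y ∈ boundedOrbits q R, y ≠ x := by
  by_contra! hK
  -- If `K = {x}`, then `x` is fixed and is its own only preimage, so it is a multiple root of `q -
  -- x`. It is then superattracting, and a small ball about it has bounded orbits.
  have hfix : q.eval x = x := hK _ (h.eval_mem_iff.2 hx)
  obtain ⟨s, hs⟩ : X - C x ∣ q - C x := by
    rw [dvd_iff_isRoot]
    simp [hfix]
  have hd : (q - C x).natDegree = q.natDegree := natDegree_sub_C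
  have hs0 : s ≠ 0 := by
    rintro rfl
    rw [mul_zero] at hs
    rw [hs, natDegree_zero] at hd
    omega
  have hsd : 0 < s.natDegree := by
    rw [hs, natDegree_mul (X_sub_C_ne_zero x) hs0, natDegree_X_sub_C] at hd
    omega
  have heval : ∀ w, q.eval w - x = (w - x) * s.eval w := fun w => by
    simpa using congrArg (eval w) hs
  have hsx : s.eval x = 0 := by
    obtain ⟨y, hy⟩ := IsAlgClosed.exists_root s (natDegree_pos_iff_degree_pos.1 hsd).ne'
    have h1 : q.eval y = x := by
      rw [← sub_eq_zero, heval, hy.eq_zero, mul_zero]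
    have h2 : y = x := hK y (h.eval_mem_iff.1 (h1 ▸ hx))
    exact h2 ▸ hy
  have hev : ∀ᶠ w in 𝓝 x, ‖s.eval w‖ < 1 :=
    s.continuous.norm.continuousAt.eventually_lt_const (by simp [hsx])
  obtain ⟨δ, hδ, hball⟩ := Metric.eventually_nhds_iff_ball.1 hev
  have hinv : ∀ n, ∀ w ∈ Metric.ball x δ, (fun w => q.eval w)^[n] w ∈ Metric.ball x δ := by
    refine fun n => Set.MapsTo.iterate (fun w hw => ?_) n
    have h1 := hball w hw
    rw [Metric.mem_ball, dist_eq_norm] at hw ⊢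
    rw [heval, norm_mul]
    nlinarith [norm_nonneg (w - x)]
  have hmem : x + (δ / 2 : ℝ) ∈ Metric.ball x δ := by
    rw [Metric.mem_ball, dist_eq_norm, add_sub_cancel_left, Complex.norm_real,
      Real.norm_of_nonneg (by linarith)]
    linarith
  have := hK _ (h.mem_of_bounded (B := ‖x‖ + δ) fun n => by
    have h1 := hinv n _ hmem
    rw [Metric.mem_ball, dist_eq_norm] at h1
    have h2 := norm_sub_norm_le ((fun w => q.eval w)^[n] (x + (δ / 2 : ℝ))) x
    linarith)
  rw [add_eq_left, Complex.ofReal_eq_zero] at this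
  linarith

end RealJulia

/-! ### Preimages of an interval whose endpoints have real preimages. -/

section RealRooted

/-- The logarithmic derivative of a real-rooted polynomial has negative imaginary part in the
upper half-plane. -/
theorem im_derivative_div_neg {f : ℂ[X]} (hf : 0 < f.natDegree)
    (hreal : ∀ z, f.eval z = 0 → z.im = 0) {z : ℂ} (hz : 0 < z.im) :
    (f.derivative.eval z / f.eval z).im < 0 := by
  have hfz : f.eval z ≠ 0 := fun h => hz.ne' (hreal z h)
  have hroots : ∀ α ∈ f.roots, (1 / (z - α)).im < 0 := by
    intro α hα
    have h0 : α.im = 0 := hreal α (isRoot_of_mem_roots hα)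
    have hne : z - α ≠ 0 := fun h => by
      rw [sub_eq_zero] at h
      rw [h, h0] at hz
      exact hz.false
    rw [one_div, Complex.inv_im, Complex.sub_im, h0, sub_zero]
    exact div_neg_of_neg_of_pos (by linarith) (Complex.normSq_pos.2 hne)
  have hne : f.roots ≠ 0 := by
    intro h
    have := (IsAlgClosed.splits f).natDegree_eq_card_roots
    rw [h, Multiset.card_zero] at this
    omega
  rw [(IsAlgClosed.splits f).eval_derivative_div_eval_of_ne_zero hfz]
  change Complex.imAddGroupHom _ < 0
  rw [map_multiset_sum, Multiset.map_map]
  have := Multiset.sum_lt_sum_of_nonempty (f := fun α => (1 / (z - α)).im) (g := fun _ => (0 : ℝ))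
    hne hroots
  simpa using this

/-- Let `w` be a highest preimage and suppose it lies above the real axis, with value `c`,
necessarily in `(a, b)`. Moving `c` along the interval moves `w` through a local inverse, so
maximality gives `Im (1 / q'(w)) = 0`. But `q'(w) / (c - a)` is the logarithmic derivative of the
real-rooted `q - a`, so it is not real. -/
theorem im_nonpos_of_eval_mem_realInterval {q : ℂ[X]} (hq : 0 < q.natDegree) {a b : ℝ}
    (ha : ∀ z, q.eval z = a → z.im = 0) (hb : ∀ z, q.eval z = b → z.im = 0) {z : ℂ}
    (hz : q.eval z ∈ realInterval a b) : z.im ≤ 0 := by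
  have hcomp : IsCompact (q.eval ⁻¹' realInterval a b) :=
    (q.isProperMap_eval (natDegree_pos_iff_degree_pos.1 hq)).isCompact_preimage
      (isCompact_realInterval a b)
  obtain ⟨w, hw, hmax⟩ := hcomp.exists_isMaxOn ⟨z, hz⟩ Complex.continuous_im.continuousOn
  refine (hmax hz).trans ?_
  by_contra! hpos
  obtain ⟨c, ⟨hac, hcb⟩, hc⟩ := hw
  have hc : (c : ℂ) = q.eval w := hc
  replace hac : a < c := lt_of_le_of_ne hac fun h => hpos.ne' (ha w (by rw [← hc, h]))
  replace hcb : c < b := lt_of_le_of_ne hcb fun h => hpos.ne' (hb w (by rw [← hc, h]))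
  have hlog := im_derivative_div_neg (f := q - C (a : ℂ)) (by rwa [natDegree_sub_C])
    (fun z hz => ha z (by simpa [sub_eq_zero] using hz)) hpos
  rw [derivative_sub, derivative_C, sub_zero, eval_sub, eval_C, ← hc, ← Complex.ofReal_sub,
    Complex.div_ofReal_im] at hlog
  have him : (q.derivative.eval w).im ≠ 0 := by
    intro h
    simp [h] at hlog
  have hne : q.derivative.eval w ≠ 0 := fun h => him (by simp [h])
  have hderiv : HasStrictDerivAt (fun z => q.eval z) (q.derivative.eval w) w :=
    q.hasStrictDerivAt w
  set g := hderiv.localInverse _ _ _ hne with hg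
  have hgd : HasDerivAt g (q.derivative.eval w)⁻¹ (c : ℂ) := by
    rw [hc]
    exact (hderiv.to_localInverse hne).hasDerivAt
  have hgw : g c = w := by
    rw [hc]
    exact (hderiv.eventually_left_inverse hne).self_of_nhds
  have hgr : ∀ᶠ t in 𝓝 (c : ℂ), q.eval (g t) = t := by
    rw [hc]
    exact hderiv.eventually_right_inverse hne
  have hφ : HasDerivAt (fun t : ℝ => (g t).im) ((q.derivative.eval w)⁻¹).im c :=
    Complex.imCLM.hasFDerivAt.comp_hasDerivAt c hgd.comp_ofReal
  have hloc : IsLocalMax (fun t : ℝ => (g t).im) c := by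
    have h1 : ∀ᶠ t : ℝ in 𝓝 c, q.eval (g t) = t :=
      Complex.continuous_ofReal.continuousAt.eventually hgr
    filter_upwards [h1, Ioo_mem_nhds hac hcb] with t ht htab
    rw [hgw]
    refine hmax ?_
    change q.eval (g t) ∈ realInterval a b
    rw [ht, ofReal_mem_realInterval]
    exact ⟨htab.1.le, htab.2.le⟩
  have := hloc.hasDerivAt_eq_zero hφ
  rw [Complex.inv_im, div_eq_zero_iff, neg_eq_zero, Complex.normSq_eq_zero] at this
  exact this.elim him hne

/-- The values on `s` form an interval containing numbers of arbitrarily large modulus; were one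
value in `(a, b)`, the interval would contain `a` or `b`. -/
theorem not_eval_mem_Ioo_of_isPreconnected {p : ℝ[X]} (hp : 0 < p.natDegree) {a b : ℝ}
    {s : Set ℝ} (hs : IsPreconnected s) (hsa : ∀ x ∈ s, p.eval x ≠ a)
    (hsb : ∀ x ∈ s, p.eval x ≠ b) {l : Filter ℝ} [l.NeBot] (hsl : s ∈ l)
    (hl : Tendsto (fun x : ℝ => ‖x‖) l atTop) {x : ℝ} (hx : x ∈ s) :
    p.eval x ∉ Set.Ioo a b := by
  intro hpx
  have hord := (hs.image _ p.continuous.continuousOn).ordConnected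
  have hlim := p.tendsto_norm_atTop (natDegree_pos_iff_degree_pos.1 hp) hl
  obtain ⟨y, hy, hys⟩ :=
    ((hlim.eventually_gt_atTop (max |a| |b|)).and (eventually_mem_set.2 hsl)).exists
  rw [max_lt_iff, Real.norm_eq_abs] at hy
  have hmx := Set.mem_image_of_mem (fun x => p.eval x) hx
  have hmy := Set.mem_image_of_mem (fun x => p.eval x) hys
  rcases lt_abs.1 hy.1 with h1 | h1
  · rcases lt_abs.1 hy.2 with h2 | h2
    · obtain ⟨t, ht, htb⟩ := hord.out hmx hmy ⟨hpx.2.le, (le_abs_self b).trans h2.le⟩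
      exact hsb t ht htb
    · linarith [abs_nonneg a, abs_nonneg b]
  · obtain ⟨t, ht, hta⟩ := hord.out hmy hmx ⟨by linarith [neg_abs_le a], hpx.1.le⟩
    exact hsa t ht hta

/-- If the preimages of `a` and `b` under a real polynomial lie in `[a, b]`, so does the preimage
of `[a, b]`. -/
theorem preimage_realInterval_subset {p : ℝ[X]} (hp : 0 < p.natDegree) {a b : ℝ}
    (ha : ∀ z, (p.map (algebraMap ℝ ℂ)).eval z = a → z ∈ realInterval a b)
    (hb : ∀ z, (p.map (algebraMap ℝ ℂ)).eval z = b → z ∈ realInterval a b) :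
    (fun z : ℂ => (p.map (algebraMap ℝ ℂ)).eval z) ⁻¹' realInterval a b ⊆ realInterval a b := by
  intro z hz
  have hdeg : 0 < (p.map (algebraMap ℝ ℂ)).natDegree := by rwa [natDegree_map]
  have hz1 : z.im ≤ 0 := im_nonpos_of_eval_mem_realInterval hdeg
    (fun z hz => (mem_realInterval.1 (ha z hz)).1)
    (fun z hz => (mem_realInterval.1 (hb z hz)).1) hz
  -- Real coefficients make the preimage symmetric under conjugation, which gives the opposite
  -- inequality.
  have hz2 : (starRingEnd ℂ z).im ≤ 0 := by
    refine im_nonpos_of_eval_mem_realInterval hdeg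
      (fun z hz => (mem_realInterval.1 (ha z hz)).1)
      (fun z hz => (mem_realInterval.1 (hb z hz)).1) (a := a) (b := b) ?_
    obtain ⟨c, hc, hcz⟩ := hz
    have hcz : (c : ℂ) = (p.map (algebraMap ℝ ℂ)).eval z := hcz
    refine ⟨c, hc, ?_⟩
    rw [eval_map_algebraMap, aeval_conj, ← eval_map_algebraMap, ← hcz, Complex.conj_ofReal]
  rw [Complex.conj_im] at hz2
  obtain ⟨x, rfl⟩ : ∃ x : ℝ, (x : ℂ) = z :=
    ⟨z.re, Complex.ext (by simp) (by simp; linarith)⟩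
  have heval : ∀ x : ℝ, (p.map (algebraMap ℝ ℂ)).eval (x : ℂ) = (p.eval x : ℝ) := fun x => by
    simpa using eval_map_apply (f := algebraMap ℝ ℂ) (p := p) x
  have hx : (p.map (algebraMap ℝ ℂ)).eval (x : ℂ) ∈ realInterval a b := hz
  rw [heval, ofReal_mem_realInterval] at hx
  have hra : ∀ y, p.eval y = a → a ≤ y ∧ y ≤ b := fun y hy =>
    ofReal_mem_realInterval.1 (ha y (by rw [heval, hy]))
  have hrb : ∀ y, p.eval y = b → a ≤ y ∧ y ≤ b := fun y hy =>
    ofReal_mem_realInterval.1 (hb y (by rw [heval, hy]))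
  rw [ofReal_mem_realInterval]
  by_contra hxab
  have hIoo : p.eval x ∈ Set.Ioo a b :=
    ⟨lt_of_le_of_ne hx.1 fun h => hxab (hra x h.symm),
      lt_of_le_of_ne hx.2 fun h => hxab (hrb x h)⟩
  rcases lt_or_ge x a with h | h
  · exact not_eval_mem_Ioo_of_isPreconnected hp (s := Set.Iio a) isPreconnected_Iio
      (fun y hy h => hy.not_ge (hra y h).1) (fun y hy h => hy.not_ge (hrb y h).1)
      (Iio_mem_atBot a) tendsto_abs_atBot_atTop h hIoo
  · have h : b < x := by
      by_contra! h'
      exact hxab ⟨h, h'⟩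
    exact not_eval_mem_Ioo_of_isPreconnected hp (s := Set.Ioi b) isPreconnected_Ioi
      (fun y hy h => hy.not_ge (hra y h).2) (fun y hy h => hy.not_ge (hrb y h).2)
      (Ioi_mem_atTop b) tendsto_abs_atTop_atTop h hIoo

end RealRooted

theorem exists_preimage_realInterval_subset {p : ℝ[X]} (hp : 1 < p.natDegree)
    (hJ : juliaSet (sphereMap (p.map (algebraMap ℝ ℂ))) ⊆ realLine) :
    ∃ a b : ℝ, a < b ∧ (fun z : ℂ => (p.map (algebraMap ℝ ℂ)).eval z) ⁻¹' realInterval a b ⊆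
      realInterval a b := by
  have hq : 1 < (p.map (algebraMap ℝ ℂ)).natDegree := by rwa [natDegree_map]
  set q := p.map (algebraMap ℝ ℂ) with hqdef
  obtain ⟨R, hR⟩ := exists_isEscapeRadius hq
  have hreal : ∀ z ∈ boundedOrbits q R, ((z.re : ℝ) : ℂ) = z := fun z hz =>
    Complex.ext (by simp) (by simp [hR.im_eq_zero_of_mem hJ hz])
  obtain ⟨x, hx⟩ := exists_isFixedPt hq
  have hxK := hR.mem_of_isFixedPt hx
  have hcomp := isCompact_boundedOrbits q R
  obtain ⟨u, huK, hu⟩ := hcomp.exists_isMinOn ⟨x, hxK⟩ Complex.continuous_re.continuousOn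
  obtain ⟨v, hvK, hv⟩ := hcomp.exists_isMaxOn ⟨x, hxK⟩ Complex.continuous_re.continuousOn
  have hsub : ∀ z ∈ boundedOrbits q R, z ∈ realInterval u.re v.re := fun z hz =>
    mem_realInterval.2 ⟨hR.im_eq_zero_of_mem hJ hz, hu hz, hv hz⟩
  refine ⟨u.re, v.re, ?_, preimage_realInterval_subset (by omega) ?_ ?_⟩
  · refine lt_of_le_of_ne (hu hvK) fun huv => ?_
    obtain ⟨y, hyK, hy⟩ := hR.exists_ne_mem hq huK
    refine hy ?_
    rw [← hreal y hyK, ← hreal u huK, le_antisymm ((hv hyK).trans huv.ge) (hu hyK)]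
  · intro z hz
    rw [hreal u huK] at hz
    exact hsub z (hR.eval_mem_iff.1 (hz ▸ huK))
  · intro z hz
    rw [hreal v hvK] at hz
    exact hsub z (hR.eval_mem_iff.1 (hz ▸ hvK))

/-! ### Lower and upper derivative bounds off an interval. -/

section OmittedInterval

/-- The sign of `Re (v / (z - α))` is that of the inner product of `v` and `z - α`, so a direction
`v` separating `z` from the interval works; compactness makes the bound uniform. -/
theorem exists_le_re_div_sub {a b : ℝ} {z : ℂ} (hz : z ∉ realInterval a b) :
    ∃ v : ℂ, ∃ c > 0, ∀ α ∈ realInterval a b, c ≤ (v / (z - α)).re := by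
  obtain ⟨v, hv⟩ : ∃ v : ℂ, ∀ α ∈ realInterval a b, 0 < v.re * (z - α).re + v.im * (z - α).im := by
    rw [mem_realInterval] at hz
    by_cases h0 : z.im = 0
    · by_cases h1 : a ≤ z.re
      · refine ⟨1, fun α hα => ?_⟩
        rw [mem_realInterval] at hα
        have h2 : b < z.re := by
          by_contra! h2
          exact hz ⟨h0, h1, h2⟩
        simp
        linarith
      · refine ⟨-1, fun α hα => ?_⟩
        rw [mem_realInterval] at hα
        simp
        linarith
    · refine ⟨⟨0, z.im⟩, fun α hα => ?_⟩
      rw [mem_realInterval] at hα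
      simp only [Complex.sub_im, hα.1, zero_mul, zero_add, sub_zero]
      exact mul_self_pos.2 h0
  have hne : ∀ α ∈ realInterval a b, z - α ≠ 0 := fun α hα h => by
    have := hv α hα
    simp [h] at this
  have hpos : ∀ α ∈ realInterval a b, 0 < (v / (z - α)).re := by
    intro α hα
    have h1 := Complex.normSq_pos.2 (hne α hα)
    rw [Complex.div_re, ← add_div]
    exact div_pos (hv α hα) h1
  rcases (realInterval a b).eq_empty_or_nonempty with he | hne'
  · exact ⟨v, 1, one_pos, by simp [he]⟩
  have hcont : ContinuousOn (fun α => (v / (z - α)).re) (realInterval a b) :=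
    Complex.continuous_re.comp_continuousOn
      (continuousOn_const.div (continuousOn_const.sub continuousOn_id) hne)
  obtain ⟨β, hβ, hmin⟩ := (isCompact_realInterval a b).exists_isMinOn hne' hcont
  exact ⟨v, _, hpos β hβ, fun α hα => hmin hα⟩

/-- In `v * f' / f = ∑ v / (z - α)` each root contributes real part at least `c`, so there is no
cancellation. -/
theorem natDegree_mul_le_norm_derivative {f : ℂ[X]} {s : Set ℂ} {z v : ℂ} {c : ℝ}
    (hroots : ∀ α, f.eval α = 0 → α ∈ s) (hc : ∀ α ∈ s, c ≤ (v / (z - α)).re)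
    (hfz : f.eval z ≠ 0) :
    f.natDegree * c * ‖f.eval z‖ ≤ ‖v‖ * ‖f.derivative.eval z‖ := by
  have hsp := IsAlgClosed.splits f
  have hsum : v * (f.derivative.eval z / f.eval z) =
      (f.roots.map fun α => v / (z - α)).sum := by
    rw [hsp.eval_derivative_div_eval_of_ne_zero hfz, ← Multiset.sum_map_mul_left]
    simp only [mul_one_div]
  have hre : f.natDegree * c ≤ (v * (f.derivative.eval z / f.eval z)).re := by
    rw [hsum]
    change _ ≤ Complex.reAddGroupHom _
    rw [map_multiset_sum, Multiset.map_map, hsp.natDegree_eq_card_roots]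
    have := Multiset.card_nsmul_le_sum (s := f.roots.map fun α => (v / (z - α)).re) (a := c)
      (by
        intro x hx
        obtain ⟨α, hα, rfl⟩ := Multiset.mem_map.1 hx
        exact hc α (hroots α (isRoot_of_mem_roots hα)))
    simpa using this
  have h1 := hre.trans (Complex.re_le_norm _)
  rw [norm_mul, norm_div, ← mul_div_assoc, le_div_iff₀ (norm_pos_iff.2 hfz)] at h1
  exact h1

/-- If the quotient is a real `t ≤ 0`, then `w = (a - t * b) / (1 - t)` is a convex combination of
`a` and `b`. -/
theorem div_mem_slitPlane {a b : ℝ} {w : ℂ} (hw : w ∉ realInterval a b) (hab : a ≤ b) :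
    (w - a) / (w - b) ∈ Complex.slitPlane := by
  by_contra h
  rw [Complex.mem_slitPlane_iff, not_or, not_lt, not_not] at h
  set t := ((w - a) / (w - b)).re with ht
  have hwb : w - b ≠ 0 := fun h0 => hw (by
    rw [sub_eq_zero.1 h0, ofReal_mem_realInterval]
    exact ⟨hab, le_rfl⟩)
  have hu : (w - a) / (w - b) = (t : ℂ) := Complex.ext (by simp [ht]) (by simp [h.2])
  rw [div_eq_iff hwb] at hu
  have h1 : (1 : ℝ) - t ≠ 0 := by linarith [h.1]
  have hwt : w = ((a - t * b) / (1 - t) : ℝ) := by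
    push_cast
    rw [eq_div_iff (by exact_mod_cast h1)]
    linear_combination hu
  refine hw ?_
  rw [hwt, ofReal_mem_realInterval, le_div_iff₀ (by linarith [h.1]), div_le_iff₀ (by linarith [h.1])]
  constructor <;> nlinarith [h.1]

/-- A holomorphic function near `z` which omits the interval `[a, b]` satisfies a derivative
bound in terms of its distances to `a` and `b`. -/
theorem norm_deriv_mul_le_of_omits_realInterval {F : ℂ → ℂ} (hF : Differentiable ℂ F) {a b : ℝ}
    (hab : a ≤ b) {z : ℂ} {r : ℝ} (hr : 0 < r)
    (hom : ∀ w ∈ Metric.closedBall z r, F w ∉ realInterval a b) :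
    ‖deriv F z‖ * (b - a) ≤ Real.exp Real.pi / r * Real.exp Real.pi * (‖F z - a‖ * ‖F z - b‖) := by
  have hb : ∀ w ∈ Metric.closedBall z r, F w - b ≠ 0 := fun w hw h => hom w hw (by
    rw [sub_eq_zero.1 h, ofReal_mem_realInterval]
    exact ⟨hab, le_rfl⟩)
  have ha : ∀ w ∈ Metric.closedBall z r, F w - a ≠ 0 := fun w hw h => hom w hw (by
    rw [sub_eq_zero.1 h, ofReal_mem_realInterval]
    exact ⟨le_rfl, hab⟩)
  -- `G` is the `i`-th power of `(F - a) / (F - b)`. Its modulus depends only on the argument, so it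
  -- lies between `exp (-π)` and `exp π`: the upper bound feeds Cauchy's estimate, the lower one
  -- allows division by `G z`.
  set G : ℂ → ℂ := fun w => Complex.exp (Complex.I * Complex.log ((F w - a) / (F w - b))) with hG
  have hnorm : ∀ w, ‖G w‖ = Real.exp (-((F w - a) / (F w - b)).arg) := fun w => by
    simp [hG, Complex.norm_exp, Complex.log_im]
  have hder : ∀ w ∈ Metric.closedBall z r, HasDerivAt G (G w * (Complex.I *
      ((deriv F w * (F w - b) - (F w - a) * deriv F w) / (F w - b) ^ 2 /
        ((F w - a) / (F w - b))))) w := by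
    intro w hw
    have h1 := (hF w).hasDerivAt
    exact ((((h1.sub_const (a : ℂ)).div (h1.sub_const (b : ℂ)) (hb w hw)).clog
      (div_mem_slitPlane (hom w hw) hab)).const_mul Complex.I).cexp
  have hd : DiffContOnCl ℂ G (Metric.ball z r) :=
    DifferentiableOn.diffContOnCl_ball
      (fun w hw => (hder w hw).differentiableAt.differentiableWithinAt) le_rfl
  have hcauchy := Complex.norm_deriv_le_of_forall_mem_sphere_norm_le (C := Real.exp Real.pi) hr hd
    fun w _ => by
      rw [hnorm, Real.exp_le_exp]
      linarith [Complex.neg_pi_lt_arg ((F w - a) / (F w - b))]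
  have hz : z ∈ Metric.closedBall z r := Metric.mem_closedBall_self hr.le
  have hL : (deriv F z * (F z - b) - (F z - a) * deriv F z) / (F z - b) ^ 2 /
      ((F z - a) / (F z - b)) = deriv F z * (a - b) / ((F z - a) * (F z - b)) := by
    have := ha z hz
    have := hb z hz
    field_simp
    ring
  have hab' : ‖(a - b : ℂ)‖ = b - a := by
    rw [norm_sub_rev, ← Complex.ofReal_sub, Complex.norm_real, Real.norm_of_nonneg (by linarith)]
  have hpos : 0 < ‖F z - a‖ * ‖F z - b‖ :=
    mul_pos (norm_pos_iff.2 (ha z hz)) (norm_pos_iff.2 (hb z hz))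
  rw [(hder z hz).deriv, hL, norm_mul, norm_mul, Complex.norm_I, one_mul, norm_div, norm_mul,
    norm_mul, hab', hnorm] at hcauchy
  have hlow : Real.exp (-Real.pi) ≤ Real.exp (-((F z - a) / (F z - b)).arg) := by
    rw [Real.exp_le_exp]
    linarith [Complex.arg_le_pi ((F z - a) / (F z - b))]
  set Q := ‖deriv F z‖ * (b - a) / (‖F z - a‖ * ‖F z - b‖) with hQ
  have hQ0 : 0 ≤ Q := div_nonneg (mul_nonneg (norm_nonneg _) (by linarith)) hpos.le
  have h1 : Real.exp (-Real.pi) * Q ≤ Real.exp Real.pi / r :=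
    (mul_le_mul_of_nonneg_right hlow hQ0).trans hcauchy
  rw [← div_le_iff₀ hpos, ← hQ]
  calc Q = Real.exp (-Real.pi) * Q * Real.exp Real.pi := by
        rw [mul_right_comm, ← Real.exp_add, neg_add_cancel, Real.exp_zero, one_mul]
    _ ≤ _ := by gcongr

end OmittedInterval

/-- The two derivative bounds are compared at `z` for every iterate; backward invariance of `[a, b]`
supplies the hypotheses of both, with `v`, `c` and `r` independent of `n`. -/
theorem boundedOrbits_subset_realInterval {q : ℂ[X]} (hq : 1 < q.natDegree) {a b : ℝ} (hab : a < b)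
    (hpre : (fun z : ℂ => q.eval z) ⁻¹' realInterval a b ⊆ realInterval a b) (R : ℝ) :
    boundedOrbits q R ⊆ realInterval a b := by
  intro z hzK
  by_contra hz
  have hiter : ∀ n, ∀ w, (fun w => q.eval w)^[n] w ∈ realInterval a b → w ∈ realInterval a b := by
    intro n
    induction n with
    | zero => exact fun w hw => hw
    | succ n ih => exact fun w hw => hpre (ih _ hw)
  obtain ⟨v, c, hc, hv⟩ := exists_le_re_div_sub hz
  obtain ⟨r, hr, hball⟩ := Metric.nhds_basis_closedBall.mem_iff.1
    ((isCompact_realInterval a b).isClosed.isOpen_compl.mem_nhds hz)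
  set A := Real.exp Real.pi / r * Real.exp Real.pi with hA
  have hA0 : 0 < A := by positivity
  have hbound : ∀ n : ℕ, (2 : ℝ) ^ n ≤ ‖v‖ * (A * (R + |b|)) / (c * (b - a)) := by
    intro n
    set P : ℂ[X] := q.comp^[n] X with hP
    have hPe : ∀ w, P.eval w = (fun w => q.eval w)^[n] w := fun w => by
      rw [hP, iterate_comp_eval, eval_X]
    have hPd : (P - C (a : ℂ)).natDegree = q.natDegree ^ n := by
      rw [natDegree_sub_C, hP, natDegree_iterate_comp, natDegree_X, mul_one]
    have haz : (P - C (a : ℂ)).eval z ≠ 0 := fun h => hz (hiter n z (by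
      rw [← hPe, sub_eq_zero.1 (by simpa using h : P.eval z - a = 0), ofReal_mem_realInterval]
      exact ⟨le_rfl, hab.le⟩))
    have hlow := natDegree_mul_le_norm_derivative (f := P - C (a : ℂ)) (s := realInterval a b)
      (fun α hα => hiter n α (by
        rw [← hPe, sub_eq_zero.1 (by simpa using hα : P.eval α - a = 0), ofReal_mem_realInterval]
        exact ⟨le_rfl, hab.le⟩)) hv haz
    have hup := norm_deriv_mul_le_of_omits_realInterval P.differentiable hab.le hr
      (fun w hw h => hball hw (hiter n w (hPe w ▸ h)))
    rw [← hA, Polynomial.deriv] at hup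
    have hpos := norm_pos_iff.2 haz
    rw [hPd, derivative_sub, derivative_C, sub_zero] at hlow
    rw [eval_sub, eval_C] at hlow hpos
    have hPb : ‖P.eval z - b‖ ≤ R + |b| := by
      refine (norm_sub_le _ _).trans (add_le_add ?_ ?_)
      · rw [hPe]
        exact hzK n
      · rw [Complex.norm_real, Real.norm_eq_abs]
    have h2 : (2 : ℝ) ^ n ≤ ((q.natDegree ^ n : ℕ) : ℝ) := by
      exact_mod_cast Nat.pow_le_pow_left hq n
    have hba : 0 < b - a := by linarith
    rw [le_div_iff₀ (mul_pos hc hba)]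
    -- The factor `‖P z - a‖` occurs in both bounds and cancels, so no lower bound on it is needed.
    refine le_of_mul_le_mul_right ?_ hpos
    calc 2 ^ n * (c * (b - a)) * ‖P.eval z - a‖
        ≤ ((q.natDegree ^ n : ℕ) : ℝ) * (c * (b - a)) * ‖P.eval z - a‖ := by gcongr
      _ = ((q.natDegree ^ n : ℕ) : ℝ) * c * ‖P.eval z - a‖ * (b - a) := by ring
      _ ≤ ‖v‖ * ‖P.derivative.eval z‖ * (b - a) := by gcongr
      _ = ‖v‖ * (‖P.derivative.eval z‖ * (b - a)) := by ring
      _ ≤ ‖v‖ * (A * (‖P.eval z - a‖ * ‖P.eval z - b‖)) := by gcongr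
      _ ≤ ‖v‖ * (A * (‖P.eval z - a‖ * (R + |b|))) := by gcongr
      _ = _ := by ring
  obtain ⟨n, hn⟩ := pow_unbounded_of_one_lt (‖v‖ * (A * (R + |b|)) / (c * (b - a))) one_lt_two
  exact hn.not_ge (hbound n)

theorem juliaSet_subset_realLine {q : ℂ[X]} (hq : 1 < q.natDegree) {a b : ℝ} (hab : a < b)
    (hpre : (fun z : ℂ => q.eval z) ⁻¹' realInterval a b ⊆ realInterval a b) :
    juliaSet (sphereMap q) ⊆ realLine := by
  obtain ⟨R, hR⟩ := exists_isEscapeRadius hq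
  have hq0 : 0 < q.natDegree := by omega
  intro x hx
  induction x using OnePoint.rec with
  | infty => exact absurd (hR.infty_mem_fatouSet hq0) hx
  | coe z =>
    have hzK : z ∈ boundedOrbits q R := by
      by_contra hzK
      exact hx (hR.coe_mem_fatouSet hq0 hzK)
    exact coe_mem_realLine.2
      (mem_realInterval.1 (boundedOrbits_subset_realInterval hq hab hpre R hzK)).1

theorem mainTheorem10 (p : ℝ[X]) (hp : 1 < p.natDegree) :
    juliaSet (sphereMap (p.map (algebraMap ℝ ℂ))) ⊆ realLine ↔
      ∃ a b : ℝ, a < b ∧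
        (fun z : ℂ => (p.map (algebraMap ℝ ℂ)).eval z) ⁻¹' realInterval a b ⊆
          realInterval a b := by
  refine ⟨exists_preimage_realInterval_subset hp, ?_⟩
  rintro ⟨a, b, hab, hpre⟩
  exact juliaSet_subset_realLine (by rwa [natDegree_map]) hab hpre
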